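/- Let $s\ge 2$ and $n>s$ be integers. Call a finite set $S$ of positive integers an $s$-multiple set if no element of $S$ has more than $s$ multiples in $S$ (each element being counted among its own multiples). Let $L_{s,n}$ be the lattice obtained from the family of all $s$-multiple subsets of $[n]=\{1,\dots,n\}$, ordered by inclusion, by adjoining a top element $\hat 1$; its bottom element $\hat 0$ is the empty set. Let $\Delta_n$ be the cross-cut complex of the coatoms of $L_{s,n}$, that is, the simplicial complex whose vertices are the coatoms of $L_{s,n}$ and whose faces are the sets of coatoms that are not spanning, where a set of elements of $L_{s,n}$ is spanning if its join is $\hat 1$ and its meet is $\hat 0$. Then, for every integer $t$, the reduced simplicial homology of $\Delta_n$ over $\mathbf Z$ satisfies $$\operatorname{rank}\widetilde H_t(\Delta_n)=\begin{cases}\binom{n-2}{s-1}, & \text{if } t=s-1;\\ 0, & \text{otherwise.}\end{cases}$$ -/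

import Mathlib

/-!
Reduced simplicial homology over `ℤ`, via ordered chains.

An ordered simplex of a complex `K` is a list of vertices (repetitions allowed) whose entries all
lie in a common face of `K`; a list with `k` entries has dimension `k - 1`. The empty list is the
unique ordered simplex of dimension `-1`, which makes the homology reduced.
-/

namespace OrderedChain

variable {V : Type*}

/-- The boundary `∂ (v₀, …, vₖ) = ∑ i, (-1) ^ i • (v₀, …, v̂ᵢ, …, vₖ)` on formal `ℤ`-linear
combinations of lists; in particular `∂ (v₀) = ()` is the augmentation, and `∂ () = 0`. -/
noncomputable def boundary (V : Type*) : (List V →₀ ℤ) →ₗ[ℤ] (List V →₀ ℤ) :=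
  Finsupp.linearCombination ℤ fun l : List V =>
    ∑ i ∈ Finset.range l.length, Finsupp.single (l.eraseIdx i) ((-1 : ℤ) ^ i)

/-- The ordered simplices of `K` of dimension `t`. -/
def simplices (K : PreAbstractSimplicialComplex V) (t : ℤ) : Set (List V) :=
  {l | (l.length : ℤ) = t + 1 ∧ (l = [] ∨ ∃ F ∈ K, ∀ v ∈ l, v ∈ F)}

/-- The group of (augmented) ordered `t`-chains of `K`. -/
def chains (K : PreAbstractSimplicialComplex V) (t : ℤ) : Submodule ℤ (List V →₀ ℤ) :=
  Finsupp.supported ℤ ℤ (simplices K t)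

/-- Reduced `t`-cycles. -/
noncomputable def cycles (K : PreAbstractSimplicialComplex V) (t : ℤ) :
    Submodule ℤ (List V →₀ ℤ) :=
  chains K t ⊓ LinearMap.ker (boundary V)

/-- `t`-boundaries. -/
noncomputable def boundaries (K : PreAbstractSimplicialComplex V) (t : ℤ) :
    Submodule ℤ (List V →₀ ℤ) :=
  (chains K (t + 1)).map (boundary V)

theorem boundary_single (l : List V) :
    boundary V (Finsupp.single l 1) =
      ∑ i ∈ Finset.range l.length, Finsupp.single (l.eraseIdx i) ((-1 : ℤ) ^ i) := by
  simp [boundary]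

theorem boundary_cons (a : V) (l : List V) :
    boundary V (Finsupp.single (a :: l) 1) =
      Finsupp.single l 1 -
        Finsupp.lmapDomain ℤ ℤ (List.cons a) (boundary V (Finsupp.single l 1)) := by
  rw [boundary_single, boundary_single, List.length_cons, Finset.sum_range_succ', map_sum]
  simp only [List.eraseIdx_cons_succ, List.eraseIdx_cons_zero, Finsupp.lmapDomain_apply,
    Finsupp.mapDomain_single, pow_succ, mul_neg, mul_one, Finsupp.single_neg,
    Finset.sum_neg_distrib, pow_zero]
  abel

theorem boundary_lmapDomain_cons (a : V) (x : List V →₀ ℤ) :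
    boundary V (Finsupp.lmapDomain ℤ ℤ (List.cons a) x) =
      x - Finsupp.lmapDomain ℤ ℤ (List.cons a) (boundary V x) := by
  suffices h : (boundary V) ∘ₗ Finsupp.lmapDomain ℤ ℤ (List.cons a) =
      LinearMap.id - Finsupp.lmapDomain ℤ ℤ (List.cons a) ∘ₗ boundary V from
    LinearMap.congr_fun h x
  ext1 l
  ext1
  simpa using boundary_cons a l

theorem boundary_boundary (x : List V →₀ ℤ) : boundary V (boundary V x) = 0 := by
  suffices h : (boundary V) ∘ₗ (boundary V) = 0 from LinearMap.congr_fun h x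
  ext1 l
  ext1
  change boundary V (boundary V (Finsupp.single l 1)) = 0
  induction l with
  | nil => simp [boundary_single]
  | cons a l ih => rw [boundary_cons, map_sub, boundary_lmapDomain_cons, ih]; simp

theorem boundary_mem_chains (K : PreAbstractSimplicialComplex V) (t : ℤ) {x : List V →₀ ℤ}
    (hx : x ∈ chains K (t + 1)) : boundary V x ∈ chains K t := by
  rw [boundary, Finsupp.linearCombination_apply]
  refine Submodule.sum_mem _ fun l hl => Submodule.smul_mem _ _ (Submodule.sum_mem _ fun i hi => ?_)
  obtain ⟨h1, h2⟩ := hx hl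
  have hi' : i < l.length := Finset.mem_range.1 hi
  refine Finsupp.single_mem_supported ℤ _ ⟨?_, ?_⟩
  · rw [List.length_eraseIdx_of_lt hi']
    omega
  · rcases h2 with rfl | ⟨F, hF, h⟩
    · simp at hi'
    · exact Or.inr ⟨F, hF, fun v hv => h v (List.mem_of_mem_eraseIdx hv)⟩

theorem boundaries_le_cycles (K : PreAbstractSimplicialComplex V) (t : ℤ) :
    boundaries K t ≤ cycles K t := by
  rintro _ ⟨x, hx, rfl⟩
  exact ⟨boundary_mem_chains K t hx, boundary_boundary x⟩

end OrderedChain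

/-- The reduced simplicial homology group of `K` over `ℤ` in degree `t`: cycles modulo
boundaries. -/
abbrev ReducedHomology {V : Type*} (K : PreAbstractSimplicialComplex V) (t : ℤ) : Type _ :=
  OrderedChain.cycles K t ⧸ (OrderedChain.boundaries K t).submoduleOf (OrderedChain.cycles K t)

/-- A set of elements of a bounded lattice (the order is all that is used) is spanning if its join
is `⊤` and its meet is `⊥`. -/
def IsSpanning {L : Type*} [PartialOrder L] [BoundedOrder L] (S : Set L) : Prop :=
  IsLUB S ⊤ ∧ IsGLB S ⊥

/-- The cross-cut complex of `C`: its (nonempty) faces are the nonempty finite subsets of `C` that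
are not spanning. -/
def crosscutComplex {L : Type*} [PartialOrder L] [BoundedOrder L] (C : Set L) :
    PreAbstractSimplicialComplex L where
  faces := {S | S.Nonempty ∧ (S : Set L) ⊆ C ∧ ¬ IsSpanning (S : Set L)}
  isRelLowerSet_faces := by
    rintro S ⟨hS, hC, hsp⟩
    refine ⟨hS, fun T hTS hT => ⟨hT, fun x hx => hC (hTS hx), fun h => hsp ⟨?_, ?_⟩⟩⟩
    · exact ⟨fun _ _ => le_top, fun b hb => h.1.2 fun x hx => hb (hTS hx)⟩
    · exact ⟨fun _ _ => bot_le, fun b hb => h.2.2 fun x hx => hb (hTS hx)⟩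

/-- `S` is an `s`-multiple set: no element of `S` has more than `s` multiples in `S`
(itself included). -/
def IsMultipleSet (s : ℕ) (S : Finset ℕ) : Prop :=
  ∀ d ∈ S, (S.filter fun m => d ∣ m).card ≤ s

/-- The family of `s`-multiple subsets of `[n] = {1, …, n}`, ordered by inclusion. -/
abbrev MultipleFamily (s n : ℕ) : Type :=
  {S : Finset ℕ // S ⊆ Finset.Icc 1 n ∧ IsMultipleSet s S}

instance (s n : ℕ) : OrderBot (MultipleFamily s n) where
  bot := ⟨∅, Finset.empty_subset _, fun _ h => absurd h (Finset.notMem_empty _)⟩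
  bot_le S := Finset.empty_subset S.1

/-- The lattice of `s`-multiple subsets of `[n]` with a top element adjoined. -/
abbrev MultipleLattice (s n : ℕ) : Type :=
  WithTop (MultipleFamily s n)

/-- The cross-cut complex of the coatoms of the lattice of `s`-multiple subsets of `[n]`. -/
def multipleComplex (s n : ℕ) : PreAbstractSimplicialComplex (MultipleLattice s n) :=
  crosscutComplex {x | IsCoatom x}

/-!
Call a set of coatoms spanning when its join is `⊤` and its meet is `⊥`. Two different facets of
the complex of `s`-multiple sets already have join `⊤`, so the faces of the cross-cut complex are the
sets of facets with a common element (`multipleComplex_eq_nerve`): the cross-cut complex is the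
nerve of the membership relation between facets and elements of `[n]`.

Everything takes place among nerves of relations `R : V → ι → Prop`, whose faces are the finite sets
of vertices with a common neighbour. Two facts suffice.

* If every neighbourhood of `R` is contained in a neighbourhood of `Q` and conversely, then the two
  nerves have the same homology (`nonempty_reducedHomology_nerve_equiv`). The vertex maps realizing
  the containments are mutually inverse up to the prism homotopy. Likewise, a nerve in which every
  neighbourhood can be enlarged to contain a fixed `p` is acyclic (`cycles_nerve_le_of_enlarge`).
* Singling out one `i₀ : ι` writes the nerve as the union of the full simplex on the neighbours of
  `i₀` and the nerve of the relation without `i₀`, which meet in the nerve of the relation without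
  `i₀` on the neighbours of `i₀` (`isGluing_nerve`). As the simplex is acyclic, Mayer–Vietoris gives
  `0 → H̃ₜ₊₁(B) → H̃ₜ₊₁(K) → H̃ₜ(D) → 0` whenever `H̃ₜ₊₁(D)` and `H̃ₜ(B)` vanish
  (`IsGluing.rank_reducedHomology`).

The facets may first be replaced by all `s`-multiple subsets of `[n]`. Then single out the element `1`.
Since every number is a multiple of `1`, an `s`-multiple set containing `1` is `1` together with
fewer than `s` arbitrary elements of `{2, …, n}`, so the intersection is the nerve of the sets of at
most `s - 1` elements of an `(n - 1)`-element set. The rest is acyclic: by Bertrand's postulate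
there is a prime `p` with `n / 2 < p ≤ n`, and `p` can be added to every `s`-multiple subset of
`{2, …, n}`. Hence the homology is that of the intersection, shifted by one degree.

Finally, the sets of at most `k` elements of an `m`-element set, `k ≤ m`, have a nerve with homology
of rank `(m - 1).choose k` concentrated in degree `k - 1` (`hasSphereHomology_nerve_card_le`):
singling out one element of the set turns the Mayer–Vietoris sequence into Pascal's rule.
-/

/-! ### Vanishing of reduced homology -/

namespace OrderedChain

variable {V W : Type*}

theorem subsingleton_reducedHomology_iff (K : PreAbstractSimplicialComplex V) (t : ℤ) :
    Subsingleton (ReducedHomology K t) ↔ cycles K t ≤ boundaries K t := by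
  rw [Submodule.Quotient.subsingleton_iff, Submodule.submoduleOf_eq_top]

theorem rank_reducedHomology_of_cycles_le {K : PreAbstractSimplicialComplex V} {t : ℤ}
    (h : cycles K t ≤ boundaries K t) : Module.rank ℤ (ReducedHomology K t) = 0 := by
  have := (subsingleton_reducedHomology_iff K t).2 h
  exact rank_subsingleton' ℤ _

/-! ### Pushforward of chains and the prism operator -/

theorem map_supported_le {α β : Type*} {S : Set α} {p : Submodule ℤ (β →₀ ℤ)}
    (f : (α →₀ ℤ) →ₗ[ℤ] (β →₀ ℤ)) (h : ∀ a ∈ S, f (Finsupp.single a 1) ∈ p) {x : α →₀ ℤ}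
    (hx : x ∈ Finsupp.supported ℤ ℤ S) : f x ∈ p := by
  rw [Finsupp.supported_eq_span_single] at hx
  suffices H : Submodule.span ℤ ((fun i => Finsupp.single i (1 : ℤ)) '' S) ≤ p.comap f from H hx
  rw [Submodule.span_le]
  rintro _ ⟨a, ha, rfl⟩
  exact h a ha

/-- The chain map induced by a map of vertices. -/
noncomputable def push (f : V → W) : (List V →₀ ℤ) →ₗ[ℤ] (List W →₀ ℤ) :=
  Finsupp.lmapDomain ℤ ℤ (List.map f)

theorem push_single (f : V → W) (l : List V) (c : ℤ) :
    push f (Finsupp.single l c) = Finsupp.single (l.map f) c := by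
  simp [push]

theorem push_comp (f : V → W) {U : Type*} (g : W → U) (x : List V →₀ ℤ) :
    push g (push f x) = push (g ∘ f) x := by
  suffices h : push g ∘ₗ push f = push (g ∘ f) from LinearMap.congr_fun h x
  ext1 l
  ext1
  simp [push_single]

theorem push_lmapDomain_cons (f : V → W) (a : V) (x : List V →₀ ℤ) :
    push f (Finsupp.lmapDomain ℤ ℤ (List.cons a) x) =
      Finsupp.lmapDomain ℤ ℤ (List.cons (f a)) (push f x) := by
  suffices h : push f ∘ₗ Finsupp.lmapDomain ℤ ℤ (List.cons a) =
      Finsupp.lmapDomain ℤ ℤ (List.cons (f a)) ∘ₗ push f from LinearMap.congr_fun h x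
  ext1 l
  ext1
  simp [push_single]

theorem boundary_push (f : V → W) (x : List V →₀ ℤ) :
    boundary W (push f x) = push f (boundary V x) := by
  suffices h : boundary W ∘ₗ push f = push f ∘ₗ boundary V from LinearMap.congr_fun h x
  ext1 l
  ext1
  simp only [LinearMap.comp_apply, Finsupp.lsingle_apply]
  induction l with
  | nil => simp [boundary_single, push_single]
  | cons a l ih =>
    rw [push_single] at ih
    rw [push_single, List.map_cons, boundary_cons, boundary_cons, map_sub, push_single,
      push_lmapDomain_cons, ih]

/-- The prism over an ordered simplex, between the simplex and its image under `f`: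
`(v₀, …, vₖ) ↦ ∑ i, (-1) ^ i • (v₀, …, vᵢ, f vᵢ, …, f vₖ)`. -/
noncomputable def prismList (f : V → V) : List V → (List V →₀ ℤ)
  | [] => 0
  | a :: l => Finsupp.single (a :: f a :: l.map f) 1 -
      Finsupp.lmapDomain ℤ ℤ (List.cons a) (prismList f l)

/-- The linear extension of `prismList`. -/
noncomputable def prism (f : V → V) : (List V →₀ ℤ) →ₗ[ℤ] (List V →₀ ℤ) :=
  Finsupp.linearCombination ℤ (prismList f)

theorem prism_lmapDomain_cons (f : V → V) (a : V) (x : List V →₀ ℤ) :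
    prism f (Finsupp.lmapDomain ℤ ℤ (List.cons a) x) =
      Finsupp.lmapDomain ℤ ℤ (List.cons a)
        (Finsupp.lmapDomain ℤ ℤ (List.cons (f a)) (push f x)) -
      Finsupp.lmapDomain ℤ ℤ (List.cons a) (prism f x) := by
  suffices h : prism f ∘ₗ Finsupp.lmapDomain ℤ ℤ (List.cons a) =
      Finsupp.lmapDomain ℤ ℤ (List.cons a) ∘ₗ Finsupp.lmapDomain ℤ ℤ (List.cons (f a)) ∘ₗ
        push f - Finsupp.lmapDomain ℤ ℤ (List.cons a) ∘ₗ prism f from LinearMap.congr_fun h x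
  ext1 l
  ext1
  simp [prism, push_single, prismList]

/-- The prism operator is a chain homotopy from the identity to `push f`. -/
theorem boundary_prism (f : V → V) (x : List V →₀ ℤ) :
    boundary V (prism f x) = push f x - x - prism f (boundary V x) := by
  suffices h : boundary V ∘ₗ prism f = push f - LinearMap.id - prism f ∘ₗ boundary V from
    LinearMap.congr_fun h x
  ext1 l
  ext1
  change boundary V (prism f (Finsupp.single l 1)) = push f (Finsupp.single l 1) -
    Finsupp.single l 1 - prism f (boundary V (Finsupp.single l 1))
  induction l with
  | nil => simp [boundary_single, push_single, prism, prismList]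
  | cons a l ih =>
    have hc : (Finsupp.single (a :: l) 1 : List V →₀ ℤ) =
        Finsupp.lmapDomain ℤ ℤ (List.cons a) (Finsupp.single l 1) := by simp
    rw [hc]
    generalize (Finsupp.single l 1 : List V →₀ ℤ) = y at ih ⊢
    simp only [prism_lmapDomain_cons, boundary_lmapDomain_cons, push_lmapDomain_cons, map_sub,
      boundary_push, ih]
    abel

theorem prismList_mem_supported (f : V → V) (l : List V) :
    prismList f l ∈ Finsupp.supported ℤ ℤ
      {m : List V | m.length = l.length + 1 ∧ ∀ w ∈ m, w ∈ l ∨ ∃ v ∈ l, f v = w} := by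
  induction l with
  | nil => exact Submodule.zero_mem _
  | cons a l ih =>
    refine Submodule.sub_mem _ (Finsupp.single_mem_supported ℤ _ ⟨by simp, by simp; grind⟩) ?_
    have h := Submodule.mem_map_of_mem (f := Finsupp.lmapDomain ℤ ℤ (List.cons a)) ih
    rw [Finsupp.lmapDomain_supported] at h
    refine Finsupp.supported_mono ?_ h
    rintro _ ⟨m, ⟨h1, h2⟩, rfl⟩
    refine ⟨by simp [h1], fun w hw => ?_⟩
    grind

end OrderedChain

/-! ### The nerve of a relation -/

open OrderedChain

variable {V W ι : Type*}

/-- The nerve of a relation `R`: a nonempty finite set of vertices is a face when its members have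
a common `R`-neighbour. -/
def nerve (R : V → ι → Prop) : PreAbstractSimplicialComplex V where
  faces := {F | F.Nonempty ∧ ∃ i, ∀ v ∈ F, R v i}
  isRelLowerSet_faces := by
    rintro F ⟨hF, i, hi⟩
    exact ⟨hF, fun G hGF hG => ⟨hG, i, fun v hv => hi v (hGF hv)⟩⟩

theorem mem_simplices_nerve {R : V → ι → Prop} {t : ℤ} {l : List V} :
    l ∈ simplices (nerve R) t ↔ (l.length : ℤ) = t + 1 ∧ (l = [] ∨ ∃ i, ∀ v ∈ l, R v i) := by
  classical
  refine and_congr_right fun _ => ⟨?_, ?_⟩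
  · rintro (h | ⟨F, ⟨_, i, hi⟩, hF⟩)
    · exact Or.inl h
    · exact Or.inr ⟨i, fun v hv => hi v (hF v hv)⟩
  · rintro (h | ⟨i, hi⟩)
    · exact Or.inl h
    · by_cases hl : l = []
      · exact Or.inl hl
      · exact Or.inr ⟨l.toFinset, ⟨List.toFinset_nonempty_iff l |>.2 hl, i, by simpa using hi⟩,
          by simp⟩

theorem push_mem_chains_nerve {R : V → ι → Prop} {Q : W → ι → Prop} {f : V → W}
    (hf : ∀ v i, R v i → Q (f v) i) {t : ℤ} {x : List V →₀ ℤ} (hx : x ∈ chains (nerve R) t) :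
    push f x ∈ chains (nerve Q) t := by
  refine map_supported_le (push f) (fun l hl => ?_) hx
  rw [push_single]
  refine Finsupp.single_mem_supported ℤ _ ?_
  rw [mem_simplices_nerve] at hl ⊢
  refine ⟨by simpa using hl.1, hl.2.imp (by simp) fun ⟨i, hi⟩ => ⟨i, ?_⟩⟩
  simp only [List.mem_map]
  rintro _ ⟨v, hv, rfl⟩
  exact hf v i (hi v hv)

theorem prism_mem_chains_nerve {R : V → ι → Prop} {f : V → V}
    (hf : ∀ v i, R v i → R (f v) i) {t : ℤ} {x : List V →₀ ℤ} (hx : x ∈ chains (nerve R) t) :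
    prism f x ∈ chains (nerve R) (t + 1) := by
  refine map_supported_le (prism f) (fun l hl => ?_) hx
  rw [prism, Finsupp.linearCombination_single, one_smul]
  rw [mem_simplices_nerve] at hl
  obtain ⟨h1, rfl | ⟨i, hi⟩⟩ := hl
  · exact Submodule.zero_mem _
  · refine Finsupp.supported_mono ?_ (prismList_mem_supported f l)
    rintro m ⟨hm, h⟩
    refine mem_simplices_nerve.2 ⟨by rw [hm]; push_cast; rw [h1], Or.inr ⟨i, fun w hw => ?_⟩⟩
    obtain hw | ⟨v, hv, rfl⟩ := h w hw
    · exact hi w hw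
    · exact hf v i (hi v hv)

/-- A vertex map that enlarges the set of neighbours of every vertex moves a cycle of the nerve
by a boundary only. -/
theorem push_sub_mem_boundaries_nerve {R : V → ι → Prop} {f : V → V}
    (hf : ∀ v i, R v i → R (f v) i) {t : ℤ} {x : List V →₀ ℤ} (hx : x ∈ cycles (nerve R) t) :
    push f x - x ∈ boundaries (nerve R) t := by
  refine ⟨prism f x, prism_mem_chains_nerve hf hx.1, ?_⟩
  rw [boundary_prism, LinearMap.mem_ker.1 hx.2, map_zero, sub_zero]

theorem push_mem_cycles_nerve {R : V → ι → Prop} {Q : W → ι → Prop} {f : V → W}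
    (hf : ∀ v i, R v i → Q (f v) i) {t : ℤ} {x : List V →₀ ℤ} (hx : x ∈ cycles (nerve R) t) :
    push f x ∈ cycles (nerve Q) t :=
  ⟨push_mem_chains_nerve hf hx.1, by
    rw [SetLike.mem_coe, LinearMap.mem_ker, boundary_push, LinearMap.mem_ker.1 hx.2, map_zero]⟩

theorem push_mem_boundaries_nerve {R : V → ι → Prop} {Q : W → ι → Prop} {f : V → W}
    (hf : ∀ v i, R v i → Q (f v) i) {t : ℤ} {x : List V →₀ ℤ} (hx : x ∈ boundaries (nerve R) t) :
    push f x ∈ boundaries (nerve Q) t := by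
  obtain ⟨y, hy, rfl⟩ := hx
  exact ⟨push f y, push_mem_chains_nerve hf hy, boundary_push f y⟩

/-- The map of reduced homology of nerves induced by a neighbour-preserving vertex map. -/
noncomputable def nerveMap {R : V → ι → Prop} {Q : W → ι → Prop} (f : V → W)
    (hf : ∀ v i, R v i → Q (f v) i) (t : ℤ) :
    ReducedHomology (nerve R) t →ₗ[ℤ] ReducedHomology (nerve Q) t :=
  Submodule.mapQ _ _ ((push f).restrict fun _ hx => push_mem_cycles_nerve hf hx)
    fun _ hx => push_mem_boundaries_nerve hf hx

theorem nerveMap_nerveMap {R : V → ι → Prop} {Q : W → ι → Prop} (f : V → W)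
    (hf : ∀ v i, R v i → Q (f v) i) (g : W → V) (hg : ∀ w i, Q w i → R (g w) i) (t : ℤ) :
    nerveMap g hg t ∘ₗ nerveMap f hf t = LinearMap.id := by
  ext x
  refine (Submodule.Quotient.eq _).2 ?_
  change push g (push f x.1) - x.1 ∈ boundaries (nerve R) t
  rw [push_comp]
  exact push_sub_mem_boundaries_nerve (fun v i h => hg _ i (hf v i h)) x.2

/-- Nerves of families that refine each other have the same homology. -/
theorem nonempty_reducedHomology_nerve_equiv {R : V → ι → Prop} {Q : W → ι → Prop} (f : V → W)
    (hf : ∀ v i, R v i → Q (f v) i) (g : W → V) (hg : ∀ w i, Q w i → R (g w) i) (t : ℤ) :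
    Nonempty (ReducedHomology (nerve R) t ≃ₗ[ℤ] ReducedHomology (nerve Q) t) :=
  ⟨LinearEquiv.ofLinearMap (nerveMap f hf t) (nerveMap g hg t) (nerveMap_nerveMap g hg f hf t)
    (nerveMap_nerveMap f hf g hg t)⟩

/-- If every neighbourhood can be enlarged to one containing a fixed `p`, then the nerve is
acyclic: it deforms into the full simplex on the neighbours of `p`. -/
theorem cycles_nerve_le_of_enlarge {R : V → ι → Prop} {p : ι} (f : V → V)
    (hf : ∀ v i, R v i → R (f v) i) (hp : ∀ v i, R v i → R (f v) p) {v₀ : V} (hv₀ : R v₀ p)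
    (t : ℤ) : cycles (nerve R) t ≤ boundaries (nerve R) t := by
  intro x hx
  suffices h : push f x ∈ boundaries (nerve R) t by
    simpa using Submodule.sub_mem _ h (push_sub_mem_boundaries_nerve hf hx)
  refine ⟨Finsupp.lmapDomain ℤ ℤ (List.cons v₀) (push f x), ?_, ?_⟩
  · refine map_supported_le (Finsupp.lmapDomain ℤ ℤ (List.cons v₀) ∘ₗ push f) (fun l hl => ?_) hx.1
    rw [LinearMap.comp_apply, push_single, Finsupp.lmapDomain_apply, Finsupp.mapDomain_single]
    refine Finsupp.single_mem_supported ℤ _ ?_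
    rw [mem_simplices_nerve] at hl ⊢
    refine ⟨by simp [hl.1], Or.inr ⟨p, ?_⟩⟩
    obtain ⟨-, rfl | ⟨i, hi⟩⟩ := hl
    · simpa using hv₀
    · simp only [List.mem_cons, List.mem_map]
      rintro _ (rfl | ⟨v, hv, rfl⟩)
      · exact hv₀
      · exact hp v i (hi v hv)
  · rw [boundary_lmapDomain_cons, boundary_push, LinearMap.mem_ker.1 hx.2]
    simp

/-! ### Gluing an acyclic complex -/

/-- `K` is the union of `A` and `B`, and `D` is their intersection, on the level of ordered
simplices. -/
structure IsGluing (K A B D : PreAbstractSimplicialComplex V) : Prop where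
  union : ∀ t, simplices K t = simplices A t ∪ simplices B t
  inter : ∀ t, simplices D t = simplices A t ∩ simplices B t

namespace IsGluing

variable {K A B D : PreAbstractSimplicialComplex V}

theorem chains_left_le (h : IsGluing K A B D) (t : ℤ) : chains A t ≤ chains K t :=
  Finsupp.supported_mono (h.union t ▸ Set.subset_union_left)

theorem chains_right_le (h : IsGluing K A B D) (t : ℤ) : chains B t ≤ chains K t :=
  Finsupp.supported_mono (h.union t ▸ Set.subset_union_right)

theorem chains_inter (h : IsGluing K A B D) (t : ℤ) : chains D t = chains A t ⊓ chains B t := by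
  rw [chains, h.inter, Finsupp.supported_inter]
  rfl

/-- The part of a chain that lies on the simplices of `A`. -/
noncomputable def part (A : PreAbstractSimplicialComplex V) (t : ℤ) :
    (List V →₀ ℤ) →ₗ[ℤ] (List V →₀ ℤ) :=
  open scoped Classical in
  (Finsupp.supported ℤ ℤ (simplices A t)).subtype ∘ₗ Finsupp.restrictDom ℤ ℤ (simplices A t)

theorem part_mem (A : PreAbstractSimplicialComplex V) (t : ℤ) (x : List V →₀ ℤ) :
    part A t x ∈ chains A t :=
  Subtype.prop _

theorem part_apply (A : PreAbstractSimplicialComplex V) (t : ℤ) (x : List V →₀ ℤ) (l : List V)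
    [Decidable (l ∈ simplices A t)] :
    part A t x l = if l ∈ simplices A t then x l else 0 := by
  classical
  simp [part, Finsupp.restrictDom_apply, Finsupp.filter_apply]

theorem part_eq_self {t : ℤ} {x : List V →₀ ℤ} (hx : x ∈ chains A t) : part A t x = x := by
  classical
  ext l
  rw [part_apply]
  split_ifs with h
  · rfl
  · exact ((Finsupp.mem_supported' ℤ x).1 hx l h).symm

theorem sub_part_mem (h : IsGluing K A B D) {t : ℤ} {x : List V →₀ ℤ} (hx : x ∈ chains K t) :
    x - part A t x ∈ chains B t := by
  classical
  refine (Finsupp.mem_supported' ℤ _).2 fun l hl => ?_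
  rw [Finsupp.sub_apply, part_apply]
  split_ifs with h'
  · exact sub_self _
  · rw [sub_zero]
    refine (Finsupp.mem_supported' ℤ x).1 hx l ?_
    rw [h.union]
    rintro (h1 | h1) <;> contradiction

theorem part_mem_inter (h : IsGluing K A B D) {t : ℤ} {x : List V →₀ ℤ} (hx : x ∈ chains B t) :
    part A t x ∈ chains D t := by
  rw [h.chains_inter]
  refine ⟨part_mem A t x, ?_⟩
  have h1 := h.sub_part_mem (h.chains_right_le t hx)
  simpa using Submodule.sub_mem _ hx h1

theorem boundary_part_mem (h : IsGluing K A B D) {t : ℤ} {x : List V →₀ ℤ}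
    (hx : x ∈ chains K (t + 1)) (hb : boundary V x ∈ chains B t) :
    boundary V (part A (t + 1) x) ∈ cycles D t := by
  refine ⟨?_, boundary_boundary _⟩
  rw [h.chains_inter]
  refine ⟨boundary_mem_chains A t (part_mem A _ x), ?_⟩
  have h1 := boundary_mem_chains B t (h.sub_part_mem hx)
  rw [map_sub] at h1
  simpa using Submodule.sub_mem _ hb h1

theorem boundary_part_mem_of_mem_cycles (h : IsGluing K A B D) {t : ℤ} {x : List V →₀ ℤ}
    (hx : x ∈ cycles K (t + 1)) : boundary V (part A (t + 1) x) ∈ cycles D t :=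
  h.boundary_part_mem hx.1 (by rw [LinearMap.mem_ker.1 hx.2]; exact Submodule.zero_mem _)

theorem boundary_part_boundary_mem (h : IsGluing K A B D) {t : ℤ} {x : List V →₀ ℤ}
    (hx : x ∈ boundaries K t) : boundary V (part A t x) ∈ boundaries D (t - 1) := by
  obtain ⟨y, hy, rfl⟩ := hx
  -- The summand of `∂ y` coming from `A` is a cycle fixed by `part A`, so only `B` contributes.
  refine ⟨part A t (boundary V (y - part A (t + 1) y)), ?_, ?_⟩
  · rw [sub_add_cancel]
    exact h.part_mem_inter (boundary_mem_chains B t (h.sub_part_mem hy))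
  · rw [map_sub, map_sub, part_eq_self (boundary_mem_chains A t (part_mem A _ y)), map_sub,
      boundary_boundary, sub_zero]

/-- The boundary of the part in `A`, as a map from cycles of `A ∪ B` to cycles of `A ∩ B`. -/
noncomputable def boundaryPart (h : IsGluing K A B D) (t : ℤ) :
    cycles K (t + 1) →ₗ[ℤ] cycles D t :=
  (boundary V ∘ₗ part A (t + 1)).restrict fun x hx => by
    rw [LinearMap.comp_apply]
    exact h.boundary_part_mem_of_mem_cycles hx

theorem boundaryPart_le_comap (h : IsGluing K A B D) (t : ℤ) :
    (boundaries K (t + 1)).submoduleOf (cycles K (t + 1)) ≤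
      ((boundaries D t).submoduleOf (cycles D t)).comap (h.boundaryPart t) := by
  intro x hx
  have h1 := h.boundary_part_boundary_mem (x := x.1) hx
  rw [add_sub_cancel_right] at h1
  exact h1

/-- The connecting homomorphism `H̃ₜ₊₁(A ∪ B) → H̃ₜ(A ∩ B)` of the Mayer–Vietoris sequence. -/
noncomputable def connecting (h : IsGluing K A B D) (t : ℤ) :
    ReducedHomology K (t + 1) →ₗ[ℤ] ReducedHomology D t :=
  Submodule.mapQ _ _ (h.boundaryPart t) (h.boundaryPart_le_comap t)

/-- The map on homology induced by the inclusion of `B` into `A ∪ B`. -/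
noncomputable def inclusion (h : IsGluing K A B D) (t : ℤ) :
    ReducedHomology B t →ₗ[ℤ] ReducedHomology K t :=
  Submodule.mapQ _ _
    (LinearMap.id.restrict (p := cycles B t) (q := cycles K t)
      fun _ hx => ⟨h.chains_right_le t hx.1, hx.2⟩)
    fun _ hx => Submodule.map_mono (h.chains_right_le (t + 1)) hx

/-- A cycle of `A ∪ B` whose image under the connecting map bounds is homologous to a cycle
of `B`. -/
theorem exists_cycle_right (h : IsGluing K A B D) (hA : ∀ t, cycles A t ≤ boundaries A t) {t : ℤ}
    {x : List V →₀ ℤ} (hx : x ∈ cycles K (t + 1))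
    (hb : boundary V (part A (t + 1) x) ∈ boundaries D t) :
    ∃ y ∈ cycles B (t + 1), y - x ∈ boundaries K (t + 1) := by
  obtain ⟨d, hd, hdx⟩ := hb
  rw [SetLike.mem_coe, h.chains_inter] at hd
  have h1 : part A (t + 1) x - d ∈ boundaries A (t + 1) := by
    refine hA _ ⟨Submodule.sub_mem _ (part_mem A _ x) hd.1, ?_⟩
    rw [SetLike.mem_coe, LinearMap.mem_ker, map_sub, hdx, sub_self]
  refine ⟨x - part A (t + 1) x + d, ⟨Submodule.add_mem _ (h.sub_part_mem hx.1) hd.2, ?_⟩, ?_⟩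
  · rw [SetLike.mem_coe, LinearMap.mem_ker, map_add, map_sub, hdx, LinearMap.mem_ker.1 hx.2]
    abel
  · have h2 := Submodule.neg_mem _ (Submodule.map_mono (h.chains_left_le _) h1)
    have h3 : x - part A (t + 1) x + d - x = -(part A (t + 1) x - d) := by abel
    rw [h3]
    exact h2

theorem cycles_le (h : IsGluing K A B D) (hA : ∀ t, cycles A t ≤ boundaries A t) {t : ℤ}
    (hB : cycles B (t + 1) ≤ boundaries B (t + 1)) (hD : cycles D t ≤ boundaries D t) :
    cycles K (t + 1) ≤ boundaries K (t + 1) := by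
  intro x hx
  obtain ⟨y, hy, hyx⟩ := h.exists_cycle_right hA hx (hD (h.boundary_part_mem_of_mem_cycles hx))
  have := Submodule.sub_mem _ (Submodule.map_mono (h.chains_right_le _) (hB hy)) hyx
  rwa [sub_sub_cancel] at this

theorem range_inclusion (h : IsGluing K A B D) (hA : ∀ t, cycles A t ≤ boundaries A t) (t : ℤ) :
    LinearMap.range (h.inclusion (t + 1)) = LinearMap.ker (h.connecting t) := by
  apply le_antisymm
  · rintro _ ⟨x, rfl⟩
    obtain ⟨x, rfl⟩ := Submodule.Quotient.mk_surjective _ x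
    refine LinearMap.mem_ker.2 ((Submodule.Quotient.mk_eq_zero _).2 ?_)
    exact ⟨part A (t + 1) x.1, h.part_mem_inter x.2.1, rfl⟩
  · intro x hx
    obtain ⟨x, rfl⟩ := Submodule.Quotient.mk_surjective _ x
    have hx' := (Submodule.Quotient.mk_eq_zero _).1 (LinearMap.mem_ker.1 hx)
    obtain ⟨y, hy, hyx⟩ := h.exists_cycle_right hA x.2 hx'
    exact ⟨Submodule.Quotient.mk ⟨y, hy⟩, (Submodule.Quotient.eq _).2 hyx⟩

theorem injective_inclusion (h : IsGluing K A B D) {t : ℤ}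
    (hD : cycles D t ≤ boundaries D t) : Function.Injective (h.inclusion t) := by
  rw [injective_iff_map_eq_zero]
  intro x hx
  obtain ⟨x, rfl⟩ := Submodule.Quotient.mk_surjective _ x
  obtain ⟨y, hy, hyx⟩ := (Submodule.Quotient.mk_eq_zero _).1 hx
  change boundary V y = x.1 at hyx
  refine (Submodule.Quotient.mk_eq_zero _).2 ?_
  change x.1 ∈ boundaries B t
  obtain ⟨d, hd, hdy⟩ := hD (h.boundary_part_mem hy (hyx ▸ x.2.1))
  rw [SetLike.mem_coe, h.chains_inter] at hd
  refine ⟨y - part A (t + 1) y + d, Submodule.add_mem _ (h.sub_part_mem hy) hd.2, ?_⟩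
  rw [map_add, map_sub, hdy, hyx, sub_add_cancel]

theorem surjective_connecting (h : IsGluing K A B D) (hA : ∀ t, cycles A t ≤ boundaries A t)
    {t : ℤ} (hB : cycles B t ≤ boundaries B t) : Function.Surjective (h.connecting t) := by
  intro z
  obtain ⟨⟨z, hz⟩, rfl⟩ := Submodule.Quotient.mk_surjective _ z
  have hz' := hz.1
  rw [h.chains_inter] at hz'
  obtain ⟨a, ha, haz⟩ := hA t ⟨hz'.1, hz.2⟩
  obtain ⟨b, hb, hbz⟩ := hB ⟨hz'.2, hz.2⟩
  have hab : a - b ∈ cycles K (t + 1) :=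
    ⟨Submodule.sub_mem _ (h.chains_left_le _ ha) (h.chains_right_le _ hb), by
      rw [SetLike.mem_coe, LinearMap.mem_ker, map_sub, haz, hbz, sub_self]⟩
  refine ⟨Submodule.Quotient.mk ⟨a - b, hab⟩, (Submodule.Quotient.eq _).2 ?_⟩
  change boundary V (part A (t + 1) (a - b)) - z ∈ boundaries D t
  refine ⟨-part A (t + 1) b, Submodule.neg_mem _ (h.part_mem_inter hb), ?_⟩
  rw [map_sub, part_eq_self ha, map_sub, map_neg, haz]
  abel

/-- When `A` is acyclic and the relevant neighbouring groups vanish, the Mayer–Vietoris sequence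
reduces to `0 → H̃ₜ₊₁(B) → H̃ₜ₊₁(A ∪ B) → H̃ₜ(A ∩ B) → 0`. -/
theorem rank_reducedHomology (h : IsGluing K A B D) (hA : ∀ t, cycles A t ≤ boundaries A t) {t : ℤ}
    (hB : cycles B t ≤ boundaries B t) (hD : cycles D (t + 1) ≤ boundaries D (t + 1)) :
    Module.rank ℤ (ReducedHomology K (t + 1)) =
      Module.rank ℤ (ReducedHomology D t) + Module.rank ℤ (ReducedHomology B (t + 1)) := by
  rw [← rank_quotient_add_rank_of_isDomain (LinearMap.ker (h.connecting t)),
    ((h.connecting t).quotKerEquivOfSurjective (h.surjective_connecting hA hB)).rank_eq,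
    ← h.range_inclusion hA,
    (LinearEquiv.ofInjective _ (h.injective_inclusion hD)).rank_eq]

end IsGluing

/-- The nerve of a relation is glued from the full simplex on the neighbours of `i₀` and the nerve
of the relation with `i₀` left out. -/
theorem isGluing_nerve (R : V → ι → Prop) (i₀ : ι) :
    IsGluing (nerve R) (nerve fun v i => R v i ∧ i = i₀) (nerve fun v i => R v i ∧ i ≠ i₀)
      (nerve fun v i => R v i ∧ i ≠ i₀ ∧ R v i₀) where
  union t := by
    ext l
    simp only [Set.mem_union, mem_simplices_nerve, ← and_or_left]
    refine and_congr_right fun _ => ⟨?_, ?_⟩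
    · rintro (h | ⟨i, hi⟩)
      · exact Or.inl (Or.inl h)
      · by_cases h : i = i₀
        · exact Or.inl (Or.inr ⟨i, fun v hv => ⟨hi v hv, h⟩⟩)
        · exact Or.inr (Or.inr ⟨i, fun v hv => ⟨hi v hv, h⟩⟩)
    · rintro ((h | ⟨i, hi⟩) | (h | ⟨i, hi⟩))
      · exact Or.inl h
      · exact Or.inr ⟨i, fun v hv => (hi v hv).1⟩
      · exact Or.inl h
      · exact Or.inr ⟨i, fun v hv => (hi v hv).1⟩
  inter t := by
    ext l
    simp only [Set.mem_inter_iff, mem_simplices_nerve, ← and_and_left]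
    refine and_congr_right fun _ => ⟨?_, ?_⟩
    · rintro (h | ⟨i, hi⟩)
      · exact ⟨Or.inl h, Or.inl h⟩
      · exact ⟨Or.inr ⟨i₀, fun v hv => ⟨(hi v hv).2.2, rfl⟩⟩,
          Or.inr ⟨i, fun v hv => ⟨(hi v hv).1, (hi v hv).2.1⟩⟩⟩
    · rintro ⟨h | ⟨j, hj⟩, h' | ⟨i, hi⟩⟩
      · exact Or.inl h
      · exact Or.inl h
      · exact Or.inl h'
      · refine Or.inr ⟨i, fun v hv => ⟨(hi v hv).1, (hi v hv).2, ?_⟩⟩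
        obtain ⟨h1, rfl⟩ := hj v hv
        exact h1

theorem cycles_nerve_and_eq_le {R : V → ι → Prop} {v₀ : V} {i₀ : ι} (h : R v₀ i₀) (t : ℤ) :
    cycles (nerve fun v i => R v i ∧ i = i₀) t ≤
      boundaries (nerve fun v i => R v i ∧ i = i₀) t :=
  cycles_nerve_le_of_enlarge id (fun _ _ h => h) (fun _ _ h => ⟨h.2 ▸ h.1, rfl⟩)
    (v₀ := v₀) ⟨h, rfl⟩ t

/-! ### Homology concentrated in one degree -/

/-- The reduced homology of `K` vanishes outside degree `d` and has rank `r` there, as for a wedge of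
`r` spheres of dimension `d`. -/
structure HasSphereHomology {V : Type} (K : PreAbstractSimplicialComplex V) (d : ℤ) (r : ℕ) :
    Prop where
  vanish : ∀ t, t ≠ d → cycles K t ≤ boundaries K t
  rank : Module.rank ℤ (ReducedHomology K d) = r

theorem HasSphereHomology.glue {V : Type} {K A B D : PreAbstractSimplicialComplex V}
    (h : IsGluing K A B D) (hA : ∀ t, cycles A t ≤ boundaries A t) {d : ℤ} {r r' : ℕ}
    (hD : HasSphereHomology D d r) (hB : HasSphereHomology B (d + 1) r') :
    HasSphereHomology K (d + 1) (r + r') where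
  vanish t ht := by
    obtain ⟨t, rfl⟩ : ∃ u, t = u + 1 := ⟨t - 1, by omega⟩
    exact h.cycles_le hA (hB.vanish _ ht) (hD.vanish _ (by omega))
  rank := by
    rw [h.rank_reducedHomology hA (hB.vanish _ (by omega)) (hD.vanish _ (by omega)), hD.rank,
      hB.rank]
    norm_cast

theorem HasSphereHomology.of_refine {V W : Type} {R : V → ι → Prop} {Q : W → ι → Prop}
    {d : ℤ} {r : ℕ} (h : HasSphereHomology (nerve Q) d r) (f : V → W)
    (hf : ∀ v i, R v i → Q (f v) i) (g : W → V) (hg : ∀ w i, Q w i → R (g w) i) :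
    HasSphereHomology (nerve R) d r where
  vanish t ht := by
    obtain ⟨e⟩ := nonempty_reducedHomology_nerve_equiv f hf g hg t
    have := (subsingleton_reducedHomology_iff _ _).2 (h.vanish t ht)
    exact (subsingleton_reducedHomology_iff _ _).1 e.toEquiv.subsingleton
  rank := by
    obtain ⟨e⟩ := nonempty_reducedHomology_nerve_equiv f hf g hg d
    rw [e.rank_eq, h.rank]

theorem HasSphereHomology.of_acyclic {V : Type} {K : PreAbstractSimplicialComplex V}
    (h : ∀ t, cycles K t ≤ boundaries K t) (d : ℤ) : HasSphereHomology K d 0 where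
  vanish t _ := h t
  rank := by rw [rank_reducedHomology_of_cycles_le (h d), Nat.cast_zero]

/-- The complex without vertices is the `(-1)`-sphere. -/
theorem hasSphereHomology_nerve_of_forall_not {V : Type} {R : V → ι → Prop}
    (hR : ∀ v i, ¬ R v i) : HasSphereHomology (nerve R) (-1) 1 := by
  have h0 : ∀ t, t ≠ -1 → chains (nerve R) t = ⊥ := by
    intro t ht
    rw [chains, Set.eq_empty_of_forall_notMem (s := simplices (nerve R) t),
      Finsupp.supported_empty]
    intro l hl
    obtain ⟨h1, rfl | ⟨i, hi⟩⟩ := mem_simplices_nerve.1 hl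
    · simp at h1; omega
    · cases l with
      | nil => simp at h1; omega
      | cons a l => exact hR a i (hi a (by simp))
  refine ⟨fun t ht => ?_, ?_⟩
  · rw [cycles, h0 t ht, bot_inf_eq]
    exact bot_le
  · have h1 : simplices (nerve R) (-1) = {[]} := by
      ext l
      rw [mem_simplices_nerve, Set.mem_singleton_iff]
      constructor
      · rintro ⟨h, -⟩
        exact List.length_eq_zero_iff.1 (by omega)
      · rintro rfl
        simp
    have h2 : (boundaries (nerve R) (-1)).submoduleOf (cycles (nerve R) (-1)) = ⊥ := by
      rw [boundaries, h0 _ (by norm_num), Submodule.map_bot]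
      simp [Submodule.submoduleOf]
    have h3 : cycles (nerve R) (-1) = chains (nerve R) (-1) := by
      refine inf_eq_left.2 fun x hx => ?_
      refine map_supported_le (p := ⊥) (boundary V) (fun l hl => ?_) hx
      rw [h1] at hl
      obtain rfl := Set.mem_singleton_iff.1 hl
      simp [boundary_single]
    rw [(Submodule.quotEquivOfEqBot _ h2).rank_eq, h3, chains, h1,
      (Finsupp.supportedEquivFinsupp _).rank_eq]
    simp

/-! ### Sets of bounded cardinality -/

/-- The sets of at most `k` elements of a set of `m ≥ k` elements, with membership as relation: the
nerve has the homology of the `(k - 1)`-skeleton of an `(m - 1)`-simplex. Singling out an element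
`a` leaves the case `(m - 1, k)`, glued to a simplex along the case `(m - 1, k - 1)`. Allowing
fewer than `k` elements makes `a` removable from a set without replacement. -/
theorem hasSphereHomology_nerve_card_le (N : Finset ℕ) :
    ∀ k ≤ N.card, HasSphereHomology
      (nerve fun (v : Finset ℕ) i => (v ⊆ N ∧ v.card ≤ k) ∧ i ∈ v) ((k : ℤ) - 1)
      ((N.card - 1).choose k) := by
  induction N using Finset.induction_on with
  | empty =>
    intro k hk
    obtain rfl : k = 0 := by simpa using hk
    simpa using hasSphereHomology_nerve_of_forall_not (V := Finset ℕ) (ι := ℕ) (by grind)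
  | insert a N ha ih =>
    intro k hk
    obtain rfl | ⟨k, rfl⟩ : k = 0 ∨ ∃ j, k = j + 1 := by cases k <;> simp
    · simpa using hasSphereHomology_nerve_of_forall_not (V := Finset ℕ) (ι := ℕ) (by grind)
    rw [Finset.card_insert_of_notMem ha] at hk ⊢
    rw [Nat.add_sub_cancel]
    by_cases hkN : N.card = k
    · rw [hkN, Nat.choose_succ_self]
      -- Every allowed set is contained in `insert a N`, which is itself allowed.
      refine HasSphereHomology.of_acyclic
        (cycles_nerve_le_of_enlarge (p := a) (v₀ := insert a N) (fun _ => insert a N) ?_ ?_ ?_) _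
      all_goals grind
    · have hkN' : k + 1 ≤ N.card := by omega
      have hD := ih k (by omega)
      have hB := ih (k + 1) hkN'
      have hcard : N.card.choose (k + 1) =
          (N.card - 1).choose k + (N.card - 1).choose (k + 1) := by
        rw [← Nat.choose_succ_succ', Nat.sub_add_cancel (by omega)]
      rw [hcard]
      have hd : ((k + 1 : ℕ) : ℤ) - 1 = ((k : ℤ) - 1) + 1 := by push_cast; ring
      rw [hd] at hB ⊢
      refine HasSphereHomology.glue (isGluing_nerve _ a)
        (cycles_nerve_and_eq_le (v₀ := {a}) (by simp)) ?_ ?_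
      · refine hD.of_refine (fun v => v.erase a) ?_ (fun w => insert a w) ?_
        all_goals clear ih hD hB hcard; grind
      · refine hB.of_refine (fun v => v.erase a) ?_ id ?_
        · clear ih hD hB hcard
          rintro v i ⟨⟨⟨hv, hvc⟩, hi⟩, hia⟩
          have := Finset.card_erase_le (s := v) (a := a)
          grind
        · clear ih hD hB hcard
          grind

/-! ### Multiple sets -/

theorem IsMultipleSet.mono {s : ℕ} {S T : Finset ℕ} (hS : IsMultipleSet s S) (h : T ⊆ S) :
    IsMultipleSet s T := fun d hd =>
  (Finset.card_le_card (Finset.filter_subset_filter _ h)).trans (hS d (h hd))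

theorem isMultipleSet_of_card_le {s : ℕ} {S : Finset ℕ} (hS : S.card ≤ s) : IsMultipleSet s S :=
  fun _ _ => (Finset.card_filter_le _ _).trans hS

theorem IsMultipleSet.card_le {s : ℕ} {S : Finset ℕ} (hS : IsMultipleSet s S) (h : 1 ∈ S) :
    S.card ≤ s := by
  simpa using hS 1 h

/-- A prime above `n / 2` can be added to an `s`-multiple subset of `{2, …, n}`: it divides, and is
divided by, nothing else there. -/
theorem IsMultipleSet.insert_prime {s n p : ℕ} {S : Finset ℕ} (hS : IsMultipleSet s S)
    (hs : 1 ≤ s) (hp : p.Prime) (hpn : n < 2 * p) (hSn : S ⊆ Finset.Icc 2 n) :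
    IsMultipleSet s (insert p S) := by
  intro d hd
  by_cases hdp : d = p
  · subst hdp
    refine (Finset.card_le_card (t := {d}) fun m hm => ?_).trans (by simpa using hs)
    obtain ⟨hm, hdm⟩ := Finset.mem_filter.1 hm
    rw [Finset.mem_singleton]
    obtain rfl | hm := Finset.mem_insert.1 hm
    · rfl
    · obtain ⟨c, rfl⟩ := hdm
      have := Finset.mem_Icc.1 (hSn hm)
      obtain _ | _ | c := c
      · omega
      · simp
      · nlinarith
  · have hdS : d ∈ S := (Finset.mem_insert.1 hd).resolve_left hdp
    have hd2 := (Finset.mem_Icc.1 (hSn hdS)).1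
    rw [Finset.filter_insert, if_neg]
    · exact hS d hdS
    · intro h
      rcases (Nat.dvd_prime hp).1 h with h | h <;> omega

/-- Membership in the `s`-multiple subsets of `[n]`: splitting off the common element `1` leaves the
sets of fewer than `s` elements of `{2, …, n}`, while a large prime makes the rest acyclic. -/
theorem hasSphereHomology_nerve_isMultipleSet {s n : ℕ} (hs : 2 ≤ s) (hn : s < n) :
    HasSphereHomology
      (nerve fun (v : Finset ℕ) i => (v ⊆ Finset.Icc 1 n ∧ IsMultipleSet s v) ∧ i ∈ v)
      ((s : ℤ) - 1) ((n - 2).choose (s - 1)) := by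
  obtain ⟨p, hp, hp1, hp2⟩ := Nat.exists_prime_lt_and_le_two_mul (n / 2) (by omega)
  have hpn : p ≤ n := by omega
  have hd : ((s : ℤ) - 1) = (((s - 1 : ℕ) : ℤ) - 1) + 1 := by omega
  have hcard : (Finset.Icc 2 n).card = n - 1 := by simp
  have hD := hasSphereHomology_nerve_card_le (Finset.Icc 2 n) (s - 1) (by omega)
  rw [hcard, Nat.sub_sub] at hD
  have hsingle : ∀ m ∈ Finset.Icc 1 n, ({m} : Finset ℕ) ⊆ Finset.Icc 1 n ∧ IsMultipleSet s {m} :=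
    fun m hm => ⟨Finset.singleton_subset_iff.2 hm, isMultipleSet_of_card_le (by simp; omega)⟩
  have herase : ∀ v : Finset ℕ, v ⊆ Finset.Icc 1 n → v.erase 1 ⊆ Finset.Icc 2 n := by
    intro v hv x hx
    have := Finset.mem_Icc.1 (hv (Finset.mem_of_mem_erase hx))
    have := Finset.ne_of_mem_erase hx
    exact Finset.mem_Icc.2 (by omega)
  have hinsert : ∀ v : Finset ℕ, v ⊆ Finset.Icc 1 n → IsMultipleSet s v →
      insert p (v.erase 1) ⊆ Finset.Icc 1 n ∧ IsMultipleSet s (insert p (v.erase 1)) :=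
    fun v hv hvs => ⟨Finset.insert_subset (Finset.mem_Icc.2 ⟨hp.one_le, hpn⟩)
      ((Finset.erase_subset _ _).trans hv),
      (hvs.mono (Finset.erase_subset _ _)).insert_prime (by omega) hp (by omega) (herase v hv)⟩
  rw [hd, ← Nat.add_zero ((n - 2).choose (s - 1))]
  refine HasSphereHomology.glue (isGluing_nerve _ 1)
    (cycles_nerve_and_eq_le (v₀ := {1}) ⟨hsingle 1 (by simp; omega), by simp⟩)
    (hD.of_refine (fun v => v.erase 1) ?_ (fun w => insert 1 w) ?_)
    (HasSphereHomology.of_acyclic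
      (cycles_nerve_le_of_enlarge (p := p) (v₀ := {p}) (fun v => insert p (v.erase 1)) ?_ ?_ ?_) _)
  · rintro v i ⟨⟨⟨hv, hvs⟩, hi⟩, hi1, h1⟩
    have := hvs.card_le h1.2
    refine ⟨⟨herase v hv, ?_⟩, Finset.mem_erase.2 ⟨hi1, hi⟩⟩
    rw [Finset.card_erase_of_mem h1.2]
    omega
  · rintro w i ⟨⟨hw, hws⟩, hi⟩
    have := Finset.mem_Icc.1 (hw hi)
    have h1 : insert 1 w ⊆ Finset.Icc 1 n ∧ IsMultipleSet s (insert 1 w) := by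
      refine ⟨Finset.insert_subset (by simp; omega)
        (hw.trans (Finset.Icc_subset_Icc_left (by omega))), isMultipleSet_of_card_le ?_⟩
      exact (Finset.card_insert_le _ _).trans (by omega)
    exact ⟨⟨h1, Finset.mem_insert_of_mem hi⟩, by omega, h1, Finset.mem_insert_self _ _⟩
  · rintro v i ⟨⟨⟨hv, hvs⟩, hi⟩, hi1⟩
    exact ⟨⟨hinsert v hv hvs, Finset.mem_insert_of_mem (Finset.mem_erase.2 ⟨hi1, hi⟩)⟩, hi1⟩
  · rintro v i ⟨⟨⟨hv, hvs⟩, hi⟩, hi1⟩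
    exact ⟨⟨hinsert v hv hvs, Finset.mem_insert_self _ _⟩, hp.one_lt.ne'⟩
  · exact ⟨⟨hsingle p (Finset.mem_Icc.2 ⟨hp.one_le, hpn⟩), by simp⟩, hp.one_lt.ne'⟩

/-! ### The cross-cut complex as a nerve -/

theorem isCoatom_multipleLattice_iff {s n : ℕ} {x : MultipleLattice s n} :
    IsCoatom x ↔ ∃ S : MultipleFamily s n, x = S ∧ IsMax S := by
  induction x using WithTop.recTopCoe with
  | top => exact ⟨fun h => absurd rfl h.1, fun ⟨S, h, _⟩ => absurd h (WithTop.coe_ne_top).symm⟩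
  | coe S =>
    constructor
    · refine fun h => ⟨S, rfl, fun T hST => ?_⟩
      by_contra hTS
      exact WithTop.coe_ne_top (h.2 (T : MultipleLattice s n)
        (WithTop.coe_lt_coe.2 (lt_of_le_not_ge hST hTS)))
    · rintro ⟨T, hST, hT⟩
      obtain rfl := WithTop.coe_inj.1 hST
      refine ⟨WithTop.coe_ne_top, fun y hy => ?_⟩
      induction y using WithTop.recTopCoe with
      | top => rfl
      | coe U => exact absurd (WithTop.coe_lt_coe.1 hy) hT.not_lt

/-- A set of coatoms is spanning precisely when the facets have empty intersection: two different
coatoms already have join `⊤`, and a single coatom is a nonempty facet. -/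
theorem multipleComplex_eq_nerve {s n : ℕ} (hs : 2 ≤ s) (hn : s < n) :
    multipleComplex s n = nerve fun (x : MultipleLattice s n) (i : ℕ) =>
      ∃ S : MultipleFamily s n, x = S ∧ IsMax S ∧ i ∈ S.1 := by
  have hsingle : ∀ i ∈ Finset.Icc 1 n, ({i} : Finset ℕ) ⊆ Finset.Icc 1 n ∧ IsMultipleSet s {i} :=
    fun i hi => ⟨Finset.singleton_subset_iff.2 hi, isMultipleSet_of_card_le (by simp; omega)⟩
  ext F
  constructor
  · rintro ⟨hF, hC, hsp⟩
    refine ⟨hF, ?_⟩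
    have hC' : ∀ x ∈ F, ∃ S : MultipleFamily s n, x = S ∧ IsMax S := fun x hx =>
      isCoatom_multipleLattice_iff.1 (hC hx)
    suffices h : ∃ i, ∀ S : MultipleFamily s n, (S : MultipleLattice s n) ∈ F → i ∈ S.1 by
      obtain ⟨i, hi⟩ := h
      refine ⟨i, fun x hx => ?_⟩
      obtain ⟨S, rfl, hS⟩ := hC' x hx
      exact ⟨S, rfl, hS, hi S hx⟩
    by_contra hne
    push Not at hne
    refine hsp ⟨⟨fun _ _ => le_top, fun b hb => ?_⟩, ⟨fun _ _ => bot_le, fun b hb => ?_⟩⟩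
    · -- An upper bound other than `⊤` would equal every member of `F`, making `F` a singleton.
      rw [top_le_iff]
      by_contra hbt
      obtain ⟨x, hx⟩ := hF
      have hxb : ∀ y ∈ F, y = b := fun y hy => by
        by_contra hyb
        exact hbt ((hC hy).2 b (lt_of_le_of_ne (hb hy) hyb))
      obtain ⟨S, rfl, hS⟩ := hC' x hx
      have hSne : S.1.Nonempty := by
        rw [Finset.nonempty_iff_ne_empty]
        intro h0
        have h1 := hsingle 1 (by simp; omega)
        have h2 : ({1} : Finset ℕ) ⊆ S.1 :=
          hS (b := (⟨{1}, h1⟩ : MultipleFamily s n)) (by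
            change S.1 ⊆ {1}
            rw [h0]
            exact Finset.empty_subset _)
        simp [h0] at h2
      obtain ⟨i, hi⟩ := hSne
      obtain ⟨T, hT, hiT⟩ := hne i
      have hST : T = S := WithTop.coe_inj.1 ((hxb _ hT).trans (hxb _ hx).symm)
      exact hiT (hST ▸ hi)
    · induction b using WithTop.recTopCoe with
      | top =>
        obtain ⟨x, hx⟩ := hF
        exact absurd (top_le_iff.1 (hb hx)) (hC hx).1
      | coe T =>
        refine WithTop.coe_le_coe.2 fun i hi => ?_
        obtain ⟨S, hS, hiS⟩ := hne i
        exact absurd (WithTop.coe_le_coe.1 (hb hS) hi) hiS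
  · rintro ⟨hF, i, hi⟩
    refine ⟨hF, fun x hx => ?_, fun hsp => ?_⟩
    · obtain ⟨S, hx, hS, -⟩ := hi x hx
      exact isCoatom_multipleLattice_iff.2 ⟨S, hx, hS⟩
    · have hi' : i ∈ Finset.Icc 1 n := by
        obtain ⟨x, hx⟩ := hF
        obtain ⟨S, -, -, hiS⟩ := hi x hx
        exact S.2.1 hiS
      have hle : ((⟨{i}, hsingle i hi'⟩ : MultipleFamily s n) : MultipleLattice s n) ≤ ⊥ := by
        refine hsp.2.2 fun x hx => ?_
        obtain ⟨S, rfl, -, hiS⟩ := hi x hx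
        exact WithTop.coe_le_coe.2 (Finset.singleton_subset_iff.2 hiS)
      have h1 : ({i} : Finset ℕ) ⊆ ∅ :=
        (WithTop.coe_le_coe (a := (⊥ : MultipleFamily s n))).1 hle
      simp at h1

theorem exists_isMax_multipleFamily {s n : ℕ} (S : MultipleFamily s n) :
    ∃ T : MultipleFamily s n, S ≤ T ∧ IsMax T := by
  have : Finite (MultipleFamily s n) :=
    Finite.of_injective (fun S => (⟨S.1, Finset.mem_powerset.2 S.2.1⟩ : (Finset.Icc 1 n).powerset))
      fun S T h => Subtype.ext (congrArg (fun x => x.1) h)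
  obtain ⟨T, hST, hT⟩ := Finite.exists_le_maximal (p := fun _ => True) (a := S) trivial
  exact ⟨T, hST, fun U hU => hT.2 trivial hU⟩

theorem hasSphereHomology_multipleComplex {s n : ℕ} (hs : 2 ≤ s) (hn : s < n) :
    HasSphereHomology (multipleComplex s n) ((s : ℤ) - 1) ((n - 2).choose (s - 1)) := by
  rw [multipleComplex_eq_nerve hs hn]
  have hg : ∀ w : Finset ℕ, ∃ x : MultipleLattice s n, ∀ i,
      (w ⊆ Finset.Icc 1 n ∧ IsMultipleSet s w) ∧ i ∈ w →
        ∃ S : MultipleFamily s n, x = S ∧ IsMax S ∧ i ∈ S.1 := by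
    intro w
    by_cases hw : w ⊆ Finset.Icc 1 n ∧ IsMultipleSet s w
    · obtain ⟨T, hT, hmax⟩ := exists_isMax_multipleFamily (⟨w, hw⟩ : MultipleFamily s n)
      exact ⟨T, fun i hi => ⟨T, rfl, hmax, hT hi.2⟩⟩
    · exact ⟨⊤, fun i hi => absurd hi.1 hw⟩
  choose g hg using hg
  refine (hasSphereHomology_nerve_isMultipleSet hs hn).of_refine
    (fun x => (x.untopD ⊥).1) ?_ g hg
  rintro x i ⟨S, rfl, -, hi⟩
  exact ⟨S.2, hi⟩

theorem theorem9 (s n : ℕ) (hs : 2 ≤ s) (hn : s < n) (t : ℤ) :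
    Module.rank ℤ (ReducedHomology (multipleComplex s n) t) =
      if t = (s : ℤ) - 1 then (((n - 2).choose (s - 1) : ℕ) : Cardinal) else 0 := by
  have h := hasSphereHomology_multipleComplex hs hn
  split_ifs with ht
  · rw [ht, h.rank]
  · exact rank_reducedHomology_of_cycles_le (h.vanish t ht)
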